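/- A \emph{planar instance} $(G,T)$ is a finite connected simple plane graph $G$ with nonnegative edge weights, together with a set $T\subseteq V(G)$ of \emph{terminals}; $\mathrm{dist}_G$ denotes the shortest-path distance. It is a \emph{one-hole instance} if all terminals lie on the outer face of $G$. For $\varepsilon\in(0,1)$, an instance $(G',T)$ with the same set of terminals is an \emph{$\varepsilon$-emulator} for $(G,T)$ if \[ e^{-\varepsilon}\cdot \mathrm{dist}_G(x,y)\le \mathrm{dist}_{G'}(x,y)\le e^{\varepsilon}\cdot \mathrm{dist}_G(x,y)\qquad\text{for all } x,y\in T. \] An $\varepsilon$-emulator $(G',T)$ for a one-hole instance $(G,T)$ is \emph{aligned} if $(G',T)$ is also a one-hole instance and the circular orderings of the terminals on the outer faces of $G$ and $G'$ are identical (if a terminal occurs more than once on the boundary walk of an outer face, it is enough that occurrences of the terminals can be chosen so that the orderings agree). \textbf{Theorem.} There is an absolute constant $c>0$ such that for every integer $k\ge 2$ and every real $\varepsilon$ with $4/k<\varepsilon<1$ there is a one-hole instance $(G,T)$ with $|T|=k$ and positive edge weights, such that every aligned $\varepsilon$-emulator $(G',T)$ for $(G,T)$ has $|V(G')|\ge c\cdot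 k/\varepsilon$. -/

import Mathlib

/-- A connected plane graph on the finite vertex set `V`: a connected simple graph, given with a
combinatorial embedding (rotation system) of genus zero and a choice of the outer face.
A dart is an edge with an orientation. (The graph with one vertex, which has no dart, is not
covered.) -/
structure PlaneGraph (V : Type*) [Fintype V] where
  /-- the underlying simple undirected graph -/
  graph : SimpleGraph V
  connected : graph.Connected
  /-- the rotation system: the next dart, in clockwise order, with the same tail -/
  rot : Equiv.Perm graph.Dart
  rot_fst : ∀ d, (rot d).fst = d.fst
  /-- the darts that leave a vertex form a single cycle of the rotation -/
  rot_cyclic : ∀ d d', d.fst = d'.fst → rot.SameCycle d d'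
  /-- Euler's formula `|V| - |E| + |F| = 2`. The faces are the orbits of the map that sends a dart
  from `u` to `v` to the rotation successor of the reverse dart from `v` to `u`. -/
  euler : (Fintype.card V : ℤ) - (Nat.card graph.edgeSet : ℤ) +
    (Nat.card (Quotient (Equiv.Perm.SameCycle.setoid
      ((SimpleGraph.Dart.symm_involutive.toPerm
        (SimpleGraph.Dart.symm : graph.Dart → graph.Dart)).trans rot))) : ℤ) = 2
  /-- a dart of the boundary walk of the outer face -/
  outer : graph.Dart

namespace PlaneGraph

variable {V : Type*} [Fintype V] (G : PlaneGraph V)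

/-- One step along the boundary walk of a face: `d` from `u` to `v` is followed by the rotation
successor of the reverse of `d`, a dart that leaves `v`. -/
def faceNext : Equiv.Perm G.graph.Dart :=
  (SimpleGraph.Dart.symm_involutive.toPerm
    (SimpleGraph.Dart.symm : G.graph.Dart → G.graph.Dart)).trans G.rot

/-- The vertex `v` lies on the outer face. -/
def OnOuterFace (v : V) : Prop :=
  ∃ d : G.graph.Dart, G.faceNext.SameCycle G.outer d ∧ d.fst = v

/-- The vertices `v 0, …, v (k - 1)` occur in this circular order on the outer face: in one round
along the boundary walk of the outer face, started at a suitable dart `d`, one can choose an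
occurrence of each `v i` so that these occurrences come in the order `0, 1, …, k - 1`.
(A cut vertex may occur several times on the boundary walk.) -/
def IsOuterOrder {k : ℕ} (v : Fin k → V) : Prop :=
  ∃ d : G.graph.Dart, G.faceNext.SameCycle G.outer d ∧
    ∃ p : Fin k → ℕ, StrictMono p ∧
      ∀ i, p i < Function.minimalPeriod G.faceNext d ∧ ((G.faceNext ^ p i) d).fst = v i

end PlaneGraph

/-- A planar instance `(G, T)` with nonnegative edge weights: `T` is the set of terminals, each of
which is a vertex. Only the weights of edges matter. -/
structure PlanarInstance (T V : Type*) [Fintype V] extends PlaneGraph V where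
  weight : Sym2 V → ℝ
  weight_nonneg : ∀ e ∈ graph.edgeSet, 0 ≤ weight e
  /-- the terminals as vertices of the graph -/
  terminal : T ↪ V

namespace PlanarInstance

variable {T V V' : Type*} [Fintype V] [Fintype V']

/-- The shortest-path distance. -/
noncomputable def dist (G : PlanarInstance T V) (u v : V) : ℝ :=
  ⨅ p : G.graph.Walk u v, (p.edges.map G.weight).sum

/-- A one-hole instance: all terminals lie on the outer face. -/
def IsOneHole (G : PlanarInstance T V) : Prop :=
  ∀ t, G.toPlaneGraph.OnOuterFace (G.terminal t)

/-- `H` is an `ε`-emulator for `G` (with respect to the common set `T` of terminals). -/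
def IsEmulator (ε : ℝ) (H : PlanarInstance T V') (G : PlanarInstance T V) : Prop :=
  ∀ x y : T,
    Real.exp (-ε) * G.dist (G.terminal x) (G.terminal y) ≤
        H.dist (H.terminal x) (H.terminal y) ∧
      H.dist (H.terminal x) (H.terminal y) ≤
        Real.exp ε * G.dist (G.terminal x) (G.terminal y)

/-- The terminals have a common circular ordering on the outer faces of `H` and `G`. -/
def SameOuterOrder [Fintype T] (H : PlanarInstance T V') (G : PlanarInstance T V) : Prop :=
  ∃ σ : Fin (Fintype.card T) ≃ T,
    G.toPlaneGraph.IsOuterOrder (fun i => G.terminal (σ i)) ∧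
      H.toPlaneGraph.IsOuterOrder (fun i => H.terminal (σ i))

/-- `H` is an aligned `ε`-emulator for `G`. -/
def IsAlignedEmulator [Fintype T] (ε : ℝ) (H : PlanarInstance T V')
    (G : PlanarInstance T V) : Prop :=
  IsEmulator ε H G ∧ H.IsOneHole ∧ SameOuterOrder H G

end PlanarInstance

/-!
The instance is a grid in which the terminals on the lower and on the upper side are joined by two
families of staircases, one going right and one going left. The weight of an edge is the difference
of a potential along it, and the potential increases along every staircase, so all staircases are
shortest paths. The length of any other path between the same sides grows with the horizontal
distance of its ends. Hence in an emulator two nearly shortest walks that stand for staircases of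
the same family have no common vertex: at a common vertex they could exchange their ends, which
would make one of them too short.

A staircase that goes right and one that goes left and crosses it have alternating ends on the outer
face. As the emulator is aligned, the ends of the walks that replace them alternate as well, so
these walks meet. A vertex lies on at most one walk of each family, so different crossing pairs give
different vertices, and there are about `k / ε` crossing pairs.

That walks with alternating ends meet is a discrete Jordan curve theorem. By Euler's formula the
homology modulo two vanishes, so one of the walks, closed up along the outer face, bounds a set of
faces, and the other walk cannot leave this set.
-/

/-- The ends `a`, `b` and the ends `c`, `d` can be joined by two walks without common vertices. -/
def HasDisjointWalks {V : Type*} (G : SimpleGraph V) (a b c d : V) : Prop :=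
  ∃ (P : G.Walk a b) (Q : G.Walk c d), P.support.Disjoint Q.support

namespace HasDisjointWalks

variable {V : Type*} {G : SimpleGraph V} {a b c d : V}

theorem ne (h : HasDisjointWalks G a b c d) : a ≠ c := by
  obtain ⟨P, Q, hPQ⟩ := h
  rintro rfl
  exact hPQ P.start_mem_support Q.start_mem_support

theorem symm (h : HasDisjointWalks G a b c d) : HasDisjointWalks G c d a b :=
  let ⟨P, Q, hPQ⟩ := h
  ⟨Q, P, hPQ.symm⟩

theorem reverse_left (h : HasDisjointWalks G a b c d) : HasDisjointWalks G b a c d :=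
  let ⟨P, Q, hPQ⟩ := h
  ⟨P.reverse, Q, by simpa [List.disjoint_left] using hPQ⟩

theorem reverse_right (h : HasDisjointWalks G a b c d) : HasDisjointWalks G a b d c :=
  h.symm.reverse_left.symm

end HasDisjointWalks

theorem eq_of_sameCycle {α β : Type*} {f : Equiv.Perm α} {h : α → β} (hf : ∀ x, h (f x) = h x)
    {x y : α} (hxy : f.SameCycle x y) : h x = h y := by
  obtain ⟨n, rfl⟩ := hxy
  induction n using Int.induction_on with
  | zero => simp
  | succ n ih => rw [ih, add_comm, zpow_one_add, Equiv.Perm.mul_apply, hf]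
  | pred n ih =>
    rw [ih, ← hf ((f ^ (-(n : ℤ) - 1)) x), ← Equiv.Perm.mul_apply, ← zpow_one_add, add_sub_cancel]

/-- A connected graph with a rotation system of arbitrary genus: a `PlaneGraph` without Euler's
formula and without the choice of an outer face. -/
structure RotationSystem (V : Type*) where
  graph : SimpleGraph V
  connected : graph.Connected
  rot : Equiv.Perm graph.Dart
  rot_fst : ∀ d, (rot d).fst = d.fst
  rot_cyclic : ∀ d d', d.fst = d'.fst → rot.SameCycle d d'

namespace RotationSystem

open Module SimpleGraph

open scoped Classical

noncomputable section

variable {V : Type*} (M : RotationSystem V)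

/-- One step along the boundary walk of a face, as in `PlaneGraph.faceNext`. -/
def faceNext : Equiv.Perm M.graph.Dart :=
  (Dart.symm_involutive.toPerm (Dart.symm : M.graph.Dart → M.graph.Dart)).trans M.rot

theorem faceNext_fst (d : M.graph.Dart) : (M.faceNext d).fst = d.snd :=
  M.rot_fst _

theorem faceNext_symm (d : M.graph.Dart) : M.faceNext d.symm = M.rot d :=
  congrArg M.rot d.symm_symm

/-- The faces of a rotation system, encoded as the orbits of `faceNext`. -/
abbrev Face : Type _ :=
  Quotient (Equiv.Perm.SameCycle.setoid M.faceNext)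

/-- The face to the side of a dart on which the boundary walks pass. -/
def face (d : M.graph.Dart) : M.Face :=
  Quotient.mk _ d

theorem face_surjective : Function.Surjective M.face :=
  Quotient.mk_surjective

theorem face_faceNext (d : M.graph.Dart) : M.face (M.faceNext d) = M.face d :=
  Quotient.sound (Equiv.Perm.sameCycle_apply_left.2 (.refl _ _))

theorem face_faceNext_pow (n : ℕ) (d : M.graph.Dart) :
    M.face ((M.faceNext ^ n) d) = M.face d :=
  Quotient.sound (Equiv.Perm.sameCycle_pow_left.2 (.refl _ _))

/-- The edge of a dart, as an element of the edge set. -/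
def edge (d : M.graph.Dart) : M.graph.edgeSet :=
  ⟨d.edge, d.edge_mem⟩

theorem edge_eq_iff {d d' : M.graph.Dart} : M.edge d = M.edge d' ↔ d = d' ∨ d = d'.symm := by
  rw [← dart_edge_eq_iff, edge, edge, Subtype.mk.injEq]

section Propagation

variable {M} {α : Type*} {h : M.graph.Dart → α} {S : Set V}

theorem eq_of_fst_eq (hrot : ∀ d, d.fst ∈ S → h (M.rot d) = h d) {d d' : M.graph.Dart}
    (hd : d.fst ∈ S) (hdd' : d.fst = d'.fst) : h d = h d' := by
  have hinv (e : M.graph.Dart) :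
      (if (M.rot e).fst ∈ S then some (h (M.rot e)) else none) =
        if e.fst ∈ S then some (h e) else none := by
    rw [M.rot_fst]
    split_ifs with he
    · rw [hrot e he]
    · rfl
  have := eq_of_sameCycle (h := fun e => if e.fst ∈ S then some (h e) else none) hinv
    (M.rot_cyclic d d' hdd')
  simpa only [if_pos hd, if_pos (hdd' ▸ hd), Option.some.injEq] using this

theorem eq_of_walk (hrot : ∀ d, d.fst ∈ S → h (M.rot d) = h d)
    (hsymm : ∀ d, d.fst ∈ S → h d.symm = h d) {u v : V} (p : M.graph.Walk u v)
    (hp : ∀ x ∈ p.support, x ∈ S) {d d' : M.graph.Dart} (hd : d.fst = u) (hd' : d'.fst = v) :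
    h d = h d' := by
  induction p generalizing d with
  | nil => exact eq_of_fst_eq hrot (hd ▸ hp _ (by simp)) (hd.trans hd'.symm)
  | @cons a b c hab p ih =>
    have ha : a ∈ S := hp a (by simp)
    let e : M.graph.Dart := ⟨(a, b), hab⟩
    calc h d = h e := eq_of_fst_eq hrot (hd ▸ ha) hd
      _ = h e.symm := (hsymm e ha).symm
      _ = h d' := ih (fun x hx => hp x (by simp [hx])) rfl hd'

end Propagation

/-- The number, modulo two, of passages of a walk through a dart. -/
def walkChain {u v : V} (p : M.graph.Walk u v) : M.graph.Dart → ZMod 2 :=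
  fun d => (p.darts.count d : ZMod 2)

variable {M} in
theorem walkChain_eq_zero {u v : V} {p : M.graph.Walk u v} {d : M.graph.Dart}
    (hd : d ∉ p.darts) : M.walkChain p d = 0 := by
  rw [walkChain, List.count_eq_zero.2 hd, Nat.cast_zero]

theorem walkChain_cons {u v w : V} (huv : M.graph.Adj u v) (p : M.graph.Walk v w) :
    M.walkChain (.cons huv p) = Pi.single ⟨(u, v), huv⟩ 1 + M.walkChain p := by
  ext d
  simp only [walkChain, Walk.darts_cons, List.count_cons, beq_iff_eq, Pi.add_apply,
    Pi.single_apply, eq_comm (a := d), Nat.cast_add, Nat.cast_ite, Nat.cast_one, Nat.cast_zero,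
    add_comm]

/-- The stretch of the boundary walk of a face, started at `d`, between the times `a` and `b`: the
number, modulo two, of passages through a dart. -/
def faceArc (d : M.graph.Dart) (a b : ℕ) : M.graph.Dart → ZMod 2 :=
  ∑ t ∈ Finset.Ico a b, Pi.single ((M.faceNext ^ t) d) 1

section

variable {M} {d : M.graph.Dart} {a b : ℕ}

theorem faceArc_faceNext (hab : a ≤ b) {e : M.graph.Dart}
    (ha : M.faceNext e ≠ (M.faceNext ^ a) d) (hb : M.faceNext e ≠ (M.faceNext ^ b) d) :
    M.faceArc d a b (M.faceNext e) = M.faceArc d a b e := by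
  have htelescope := Finset.sum_Ico_sub
    (fun t => (Pi.single ((M.faceNext ^ t) d) 1 : M.graph.Dart → ZMod 2) (M.faceNext e)) hab
  simp only [Pi.single_eq_of_ne ha, Pi.single_eq_of_ne hb, sub_zero, Finset.sum_sub_distrib,
    sub_eq_zero] at htelescope
  rw [faceArc, Finset.sum_apply, Finset.sum_apply, ← htelescope]
  simp only [pow_succ', Equiv.Perm.mul_apply, Pi.single_apply, EmbeddingLike.apply_eq_iff_eq]

theorem faceArc_faceNext_pow {s : ℕ} (hb : b < Function.minimalPeriod M.faceNext d)
    (hs : s < Function.minimalPeriod M.faceNext d) :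
    M.faceArc d a b ((M.faceNext ^ s) d) = if s ∈ Finset.Ico a b then 1 else 0 := by
  rw [faceArc, Finset.sum_apply, ← Finset.sum_ite_eq (Finset.Ico a b) s fun _ => (1 : ZMod 2)]
  refine Finset.sum_congr rfl fun t ht => ?_
  have hpow : (M.faceNext ^ s) d = (M.faceNext ^ t) d ↔ s = t := by
    simpa only [Equiv.Perm.iterate_eq_pow] using
      Function.iterate_eq_iterate_iff_of_lt_minimalPeriod hs ((Finset.mem_Ico.1 ht).2.trans hb)
  simp only [Pi.single_apply, hpow]

end

instance [Finite V] : Finite M.Face :=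
  have := Fintype.ofFinite V
  inferInstance

variable [Fintype V]

/-- Genus zero: Euler's formula `|V| + |F| = |E| + 2`. -/
def IsPlanar : Prop :=
  Fintype.card V + Nat.card M.Face = Nat.card M.graph.edgeSet + 2

/-- The edge chain modulo two that underlies a chain of darts. -/
def edgeChain : (M.graph.Dart → ZMod 2) →ₗ[ZMod 2] (M.graph.edgeSet → ZMod 2) :=
  Fintype.linearCombination (ZMod 2) fun d => Pi.single (M.edge d) 1

/-- The boundary map modulo two from edge chains to vertex chains. -/
def vertexBoundary : (M.graph.edgeSet → ZMod 2) →ₗ[ZMod 2] (V → ZMod 2) :=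
  Fintype.linearCombination (ZMod 2) (fun d : M.graph.Dart => Pi.single d.fst 1) ∘ₗ
    LinearMap.funLeft (ZMod 2) (ZMod 2) M.edge

/-- The boundary map modulo two from face chains to edge chains. -/
def faceBoundary : (M.Face → ZMod 2) →ₗ[ZMod 2] (M.graph.edgeSet → ZMod 2) :=
  M.edgeChain ∘ₗ LinearMap.funLeft (ZMod 2) (ZMod 2) M.face

theorem edgeChain_edge (h : M.graph.Dart → ZMod 2) (d : M.graph.Dart) :
    M.edgeChain h (M.edge d) = h d + h d.symm := by
  have hfiber : Finset.univ.filter (fun d' => M.edge d = M.edge d') = {d, d.symm} := by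
    ext d'
    simp [eq_comm (a := M.edge d), edge_eq_iff]
  simp only [edgeChain, Fintype.linearCombination_apply, Finset.sum_apply, Pi.smul_apply,
    Pi.single_apply, smul_eq_mul, mul_ite, mul_one, mul_zero]
  rw [← Finset.sum_filter, hfiber, Finset.sum_pair d.symm_ne.symm]

theorem faceBoundary_edge (f : M.Face → ZMod 2) (d : M.graph.Dart) :
    M.faceBoundary f (M.edge d) = f (M.face d) + f (M.face d.symm) :=
  M.edgeChain_edge (f ∘ M.face) d

theorem vertexBoundary_edgeChain (h : M.graph.Dart → ZMod 2) :
    M.vertexBoundary (M.edgeChain h) =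
      ∑ d, h d • (Pi.single d.fst 1 + Pi.single d.snd 1 : V → ZMod 2) := by
  simp only [vertexBoundary, LinearMap.comp_apply, Fintype.linearCombination_apply,
    LinearMap.funLeft_apply, edgeChain_edge, add_smul, smul_add, Finset.sum_add_distrib]
  congr 1
  exact Equiv.sum_comp (Dart.symm_involutive.toPerm _) fun d : M.graph.Dart =>
    h d • (Pi.single d.snd 1 : V → ZMod 2)

theorem vertexBoundary_faceBoundary (f : M.Face → ZMod 2) :
    M.vertexBoundary (M.faceBoundary f) = 0 := by
  have hnext : ∑ d, f (M.face d) • (Pi.single d.snd 1 : V → ZMod 2) =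
      ∑ d, f (M.face d) • (Pi.single d.fst 1 : V → ZMod 2) := by
    simpa only [face_faceNext, faceNext_fst] using Equiv.sum_comp M.faceNext fun d =>
      f (M.face d) • (Pi.single d.fst 1 : V → ZMod 2)
  rw [faceBoundary, LinearMap.comp_apply, vertexBoundary_edgeChain]
  simp only [LinearMap.funLeft_apply, smul_add, Finset.sum_add_distrib, hnext,
    ZModModule.add_self]

theorem vertexBoundary_edgeChain_single (d : M.graph.Dart) :
    M.vertexBoundary (M.edgeChain (Pi.single d 1)) = Pi.single d.fst 1 + Pi.single d.snd 1 := by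
  simp only [vertexBoundary_edgeChain, Pi.single_apply, ite_smul, one_smul, zero_smul,
    Finset.sum_ite_eq', Finset.mem_univ, if_true]

theorem vertexBoundary_walkChain {u v : V} (p : M.graph.Walk u v) :
    M.vertexBoundary (M.edgeChain (M.walkChain p)) = Pi.single u 1 + Pi.single v 1 := by
  induction p with
  | @nil a =>
    have hnil : M.walkChain (.nil : M.graph.Walk a a) = 0 := funext fun _ => by simp [walkChain]
    rw [hnil, map_zero, map_zero, ZModModule.add_self]
  | @cons a b c hab p ih =>
    rw [walkChain_cons, map_add, map_add, ih, vertexBoundary_edgeChain_single]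
    rw [add_assoc, ← add_assoc (Pi.single b 1), ZModModule.add_self, zero_add]

theorem card_le_finrank_range_vertexBoundary_add_one :
    Fintype.card V ≤ finrank (ZMod 2) M.vertexBoundary.range + 1 := by
  obtain ⟨r⟩ := M.connected.nonempty
  let S : Submodule (ZMod 2) (V → ZMod 2) := .span (ZMod 2) {Pi.single r 1}
  have htop : M.vertexBoundary.range ⊔ S = ⊤ := by
    rw [eq_top_iff, ← (Pi.basisFun (ZMod 2) V).span_eq, Submodule.span_le]
    rintro _ ⟨v, rfl⟩
    obtain ⟨p⟩ := M.connected.preconnected v r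
    have hv : (Pi.single v 1 : V → ZMod 2) = (Pi.single v 1 + Pi.single r 1) + Pi.single r 1 := by
      rw [add_assoc, ZModModule.add_self, add_zero]
    rw [Pi.basisFun_apply, hv, ← M.vertexBoundary_walkChain p]
    exact Submodule.add_mem_sup (LinearMap.mem_range_self _ _)
      (Submodule.mem_span_singleton_self _)
  have hS : finrank (ZMod 2) S = 1 := finrank_span_singleton (by simp)
  have hle := Submodule.finrank_add_le_finrank_add_finrank M.vertexBoundary.range S
  rwa [htop, finrank_top, finrank_fintype_fun_eq_card, hS] at hle

theorem face_const_of_faceBoundary_eq_zero {f : M.Face → ZMod 2} (hf : M.faceBoundary f = 0)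
    (x y : M.Face) : f x = f y := by
  obtain ⟨d, rfl⟩ := M.face_surjective x
  obtain ⟨d', rfl⟩ := M.face_surjective y
  have hsymm (e : M.graph.Dart) : f (M.face e.symm) = f (M.face e) := by
    have := congrFun hf (M.edge e)
    rw [faceBoundary_edge] at this
    exact (CharTwo.add_eq_zero.1 this).symm
  have hrot (e : M.graph.Dart) : f (M.face (M.rot e)) = f (M.face e) := by
    rw [← faceNext_symm, face_faceNext, hsymm]
  obtain ⟨p⟩ := M.connected.preconnected d.fst d'.fst
  exact eq_of_walk (h := f ∘ M.face) (S := Set.univ) (fun e _ => hrot e) (fun e _ => hsymm e) p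
    (fun _ _ => trivial) rfl rfl

theorem finrank_ker_faceBoundary_le_one : finrank (ZMod 2) M.faceBoundary.ker ≤ 1 := by
  have hle : M.faceBoundary.ker ≤ Submodule.span (ZMod 2) {1} := fun f hf => by
    rw [Submodule.mem_span_singleton]
    cases isEmpty_or_nonempty M.Face with
    | inl _ => exact ⟨0, Subsingleton.elim _ _⟩
    | inr h =>
      obtain ⟨x⟩ := h
      exact ⟨f x, funext fun y => by
        simpa using M.face_const_of_faceBoundary_eq_zero hf x y⟩
  have hspan := finrank_span_le_card (R := ZMod 2) ({1} : Set (M.Face → ZMod 2))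
  rw [Set.toFinset_singleton, Finset.card_singleton] at hspan
  exact (Submodule.finrank_mono hle).trans hspan

theorem range_faceBoundary_le_ker_vertexBoundary :
    M.faceBoundary.range ≤ M.vertexBoundary.ker := by
  rintro _ ⟨f, rfl⟩
  exact M.vertexBoundary_faceBoundary f

theorem card_add_card_face_add_finrank_ker_le :
    Fintype.card V + Nat.card M.Face + finrank (ZMod 2) M.vertexBoundary.ker ≤
      Nat.card M.graph.edgeSet + 2 + finrank (ZMod 2) M.faceBoundary.range := by
  have h1 := M.card_le_finrank_range_vertexBoundary_add_one
  have h2 := M.finrank_ker_faceBoundary_le_one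
  have h3 := M.vertexBoundary.finrank_range_add_finrank_ker
  have h4 := M.faceBoundary.finrank_range_add_finrank_ker
  rw [finrank_fintype_fun_eq_card, ← Nat.card_eq_fintype_card] at h3 h4
  omega

theorem card_add_card_face_le :
    Fintype.card V + Nat.card M.Face ≤ Nat.card M.graph.edgeSet + 2 := by
  have h1 := M.card_add_card_face_add_finrank_ker_le
  have h2 := Submodule.finrank_mono M.range_faceBoundary_le_ker_vertexBoundary
  omega

variable {M}

theorem IsPlanar.range_faceBoundary (hM : M.IsPlanar) :
    M.faceBoundary.range = M.vertexBoundary.ker := by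
  have := M.card_add_card_face_add_finrank_ker_le
  refine Submodule.eq_of_le_of_finrank_le M.range_faceBoundary_le_ker_vertexBoundary ?_
  rw [IsPlanar] at hM
  omega

/-- A discrete Jordan curve theorem: the colour `f` of the face changes exactly across the edges of
the closed chain. -/
theorem IsPlanar.exists_face_coloring (hM : M.IsPlanar) {h : M.graph.Dart → ZMod 2}
    (hh : M.vertexBoundary (M.edgeChain h) = 0) :
    ∃ f : M.Face → ZMod 2, ∀ d, f (M.face d.symm) + h d.symm = f (M.face d) + h d := by
  rw [← LinearMap.mem_ker, ← hM.range_faceBoundary] at hh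
  obtain ⟨f, hf⟩ := hh
  refine ⟨f, fun d => ?_⟩
  have hd := congrFun hf (M.edge d)
  rw [faceBoundary_edge, edgeChain_edge, ← CharTwo.add_eq_zero] at hd
  rw [← CharTwo.add_eq_zero, ← hd]
  ring

variable {d : M.graph.Dart} {a b : ℕ}

theorem vertexBoundary_faceArc (hab : a ≤ b) :
    M.vertexBoundary (M.edgeChain (M.faceArc d a b)) =
      Pi.single ((M.faceNext ^ a) d).fst 1 + Pi.single ((M.faceNext ^ b) d).fst 1 := by
  rw [faceArc, map_sum, map_sum, add_comm, ← ZModModule.sub_eq_add,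
    ← Finset.sum_Ico_sub (fun t => (Pi.single ((M.faceNext ^ t) d).fst 1 : V → ZMod 2)) hab]
  refine Finset.sum_congr rfl fun t _ => ?_
  rw [vertexBoundary_edgeChain_single, ZModModule.sub_eq_add, pow_succ', Equiv.Perm.mul_apply,
    faceNext_fst, add_comm]

/-- The arc of the face and a walk between its ends form a closed chain. A walk that avoids the
walk between the ends can leave the arc only through a change of colour. -/
theorem IsPlanar.faceArc_eq_of_disjoint (hM : M.IsPlanar) (hab : a ≤ b)
    (P : M.graph.Walk ((M.faceNext ^ a) d).fst ((M.faceNext ^ b) d).fst) {u v : V}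
    (Q : M.graph.Walk u v) (hPQ : P.support.Disjoint Q.support) {e e' : M.graph.Dart}
    (he : e.fst = u) (he' : e'.fst = v) (hface : M.face e = M.face e') :
    M.faceArc d a b e = M.faceArc d a b e' := by
  have hclosed : M.vertexBoundary (M.edgeChain (M.walkChain P + M.faceArc d a b)) = 0 := by
    rw [map_add, map_add, vertexBoundary_walkChain, vertexBoundary_faceArc hab,
      ZModModule.add_self]
  obtain ⟨f, hf⟩ := hM.exists_face_coloring hclosed
  let g (e : M.graph.Dart) : ZMod 2 := f (M.face e) + M.faceArc d a b e
  have hsymm (e : M.graph.Dart) (he : e.fst ∉ P.support) : g e.symm = g e := by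
    have h1 : e ∉ P.darts := fun h => he (P.dart_fst_mem_support_of_mem_darts h)
    have h2 : e.symm ∉ P.darts := fun h => he (P.dart_snd_mem_support_of_mem_darts h)
    simpa only [Pi.add_apply, walkChain_eq_zero h1, walkChain_eq_zero h2, zero_add] using hf e
  have hrot (e : M.graph.Dart) (he : e.fst ∉ P.support) : g (M.rot e) = g e := by
    have hne {c : M.graph.Dart} (hc : c.fst ∈ P.support) : M.faceNext e.symm ≠ c := fun h =>
      he <| by rwa [← h, faceNext_fst] at hc
    have hnext : g (M.faceNext e.symm) = g e.symm := by
      simp only [g, face_faceNext,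
        faceArc_faceNext hab (hne P.start_mem_support) (hne P.end_mem_support)]
    rw [← faceNext_symm, hnext, hsymm e he]
  have hg : g e = g e' := eq_of_walk (S := {x | x ∉ P.support}) hrot hsymm Q
    (fun x hx hx' => hPQ hx' hx) he he'
  simpa only [g, hface, add_right_inj] using hg

theorem IsPlanar.not_hasDisjointWalks (hM : M.IsPlanar) (d : M.graph.Dart) {p₁ p₂ p₃ p₄ : ℕ}
    (h₁₂ : p₁ < p₂) (h₂₃ : p₂ < p₃) (h₃₄ : p₃ < p₄)
    (h₄ : p₄ < Function.minimalPeriod M.faceNext d) :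
    ¬ HasDisjointWalks M.graph ((M.faceNext ^ p₁) d).fst ((M.faceNext ^ p₃) d).fst
      ((M.faceNext ^ p₂) d).fst ((M.faceNext ^ p₄) d).fst := by
  rintro ⟨P, Q, hPQ⟩
  have harc := hM.faceArc_eq_of_disjoint (h₁₂.trans h₂₃).le P Q hPQ rfl rfl
    (by rw [face_faceNext_pow, face_faceNext_pow])
  rw [faceArc_faceNext_pow (h₃₄.trans h₄) (h₂₃.trans (h₃₄.trans h₄)),
    faceArc_faceNext_pow (h₃₄.trans h₄) h₄, if_pos (Finset.mem_Ico.2 ⟨h₁₂.le, h₂₃⟩),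
    if_neg (by simp [h₃₄.le])] at harc
  exact one_ne_zero harc

variable (M) in
/-- The plane graph given by a rotation system of genus zero and a dart of the outer face. -/
def toPlaneGraph (hM : M.IsPlanar) (outer : M.graph.Dart) : PlaneGraph V where
  graph := M.graph
  connected := M.connected
  rot := M.rot
  rot_fst := M.rot_fst
  rot_cyclic := M.rot_cyclic
  euler := by
    change (Fintype.card V : ℤ) - Nat.card M.graph.edgeSet + Nat.card M.Face = 2
    rw [IsPlanar] at hM
    omega
  outer := outer

end

end RotationSystem

/-- The pairs `{a, c}` and `{b, d}` alternate in the linear order: exactly one of `b` and `d` lies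
strictly between `a` and `c`. -/
def Alternate {α : Type*} [LinearOrder α] (a b c d : α) : Prop :=
  Xor (b ∈ Set.uIoo a c) (d ∈ Set.uIoo a c)

theorem alternate_trichotomy {α : Type*} [LinearOrder α] {a b c d : α} (hab : a ≠ b) (hac : a ≠ c)
    (had : a ≠ d) (hbc : b ≠ c) (hbd : b ≠ d) (hcd : c ≠ d) :
    Alternate a b c d ∨ Alternate a c b d ∨ Alternate a b d c := by
  simp only [Alternate, Xor, Set.uIoo, Set.mem_Ioo, inf_lt_iff, lt_sup_iff]
  grind

namespace PlaneGraph

variable {V : Type*} [Fintype V] (G : PlaneGraph V)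

/-- The rotation system of a plane graph. -/
def toRotationSystem : RotationSystem V where
  graph := G.graph
  connected := G.connected
  rot := G.rot
  rot_fst := G.rot_fst
  rot_cyclic := G.rot_cyclic

theorem isPlanar_toRotationSystem : G.toRotationSystem.IsPlanar := by
  have h : (Fintype.card V : ℤ) - Nat.card G.toRotationSystem.graph.edgeSet +
    Nat.card G.toRotationSystem.Face = 2 := G.euler
  rw [RotationSystem.IsPlanar]
  omega

variable {G} {k : ℕ} {v : Fin k → V} {a b c d : Fin k}

theorem IsOuterOrder.not_hasDisjointWalks_of_lt (hv : G.IsOuterOrder v) (hab : a < b) (hbc : b < c)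
    (hcd : c < d) : ¬ HasDisjointWalks G.graph (v a) (v c) (v b) (v d) := by
  obtain ⟨e, -, p, hp, hpv⟩ := hv
  rw [← (hpv a).2, ← (hpv b).2, ← (hpv c).2, ← (hpv d).2]
  exact G.isPlanar_toRotationSystem.not_hasDisjointWalks e (hp hab) (hp hbc) (hp hcd) (hpv d).1

theorem IsOuterOrder.not_hasDisjointWalks (hv : G.IsOuterOrder v) (h : Alternate a b c d) :
    ¬ HasDisjointWalks G.graph (v a) (v c) (v b) (v d) := by
  intro hG
  wlog hac : a ≤ c generalizing a c
  · exact this (by rwa [Alternate, Set.uIoo_comm]) hG.reverse_left (le_of_not_ge hac)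
  wlog hb : b ∈ Set.uIoo a c generalizing b d
  · exact this h.symm hG.reverse_right (h.or.resolve_left hb)
  have had : a ≠ d := ne_of_apply_ne v hG.reverse_right.ne
  have hcd : c ≠ d := ne_of_apply_ne v hG.reverse_left.reverse_right.ne
  have hd : d ∉ Set.uIoo a c := fun hd => (xor_iff_or_and_not_and _ _).1 h |>.2 ⟨hb, hd⟩
  rw [Set.uIoo_of_le hac, Set.mem_Ioo] at hb hd
  rcases lt_or_gt_of_ne had with had | hda
  · have hle : c ≤ d := not_lt.1 fun hdc => hd ⟨had, hdc⟩
    exact hv.not_hasDisjointWalks_of_lt hb.1 hb.2 (hcd.lt_of_le hle) hG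
  · exact hv.not_hasDisjointWalks_of_lt hda hb.1 hb.2 hG.reverse_right.symm

end PlaneGraph

namespace PlanarInstance

variable {T V V' : Type*} [Fintype T] [Fintype V] [Fintype V']

/-- The disjoint walks in `G` exclude that the pairs `ab`, `cd` or `ad`, `bc` alternate, hence `ac`
and `bd` do. -/
theorem SameOuterOrder.not_hasDisjointWalks {H : PlanarInstance T V'} {G : PlanarInstance T V}
    (hHG : SameOuterOrder H G) {a b c d : T} (hab : a ≠ b) (hac : a ≠ c) (had : a ≠ d)
    (hbc : b ≠ c) (hbd : b ≠ d) (hcd : c ≠ d)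
    (h₁ : HasDisjointWalks G.graph (G.terminal a) (G.terminal b) (G.terminal c) (G.terminal d))
    (h₂ : HasDisjointWalks G.graph (G.terminal a) (G.terminal d) (G.terminal b) (G.terminal c)) :
    ¬ HasDisjointWalks H.graph (H.terminal a) (H.terminal c) (H.terminal b) (H.terminal d) := by
  obtain ⟨σ, hσG, hσH⟩ := hHG
  obtain ⟨a, rfl⟩ := σ.surjective a
  obtain ⟨b, rfl⟩ := σ.surjective b
  obtain ⟨c, rfl⟩ := σ.surjective c
  obtain ⟨d, rfl⟩ := σ.surjective d
  simp only [ne_eq, EmbeddingLike.apply_eq_iff_eq] at hab hac had hbc hbd hcd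
  rcases alternate_trichotomy hab hac had hbc hbd hcd with h | h | h
  · exact hσH.not_hasDisjointWalks h
  · exact absurd h₁ (hσG.not_hasDisjointWalks h)
  · exact absurd h₂ (hσG.not_hasDisjointWalks h)

end PlanarInstance

namespace PlanarInstance

open SimpleGraph

section Length

variable {T V : Type*} [Fintype V] (G : PlanarInstance T V)

/-- The length of a walk: the sum of the weights of its edges. -/
def length {u v : V} (p : G.graph.Walk u v) : ℝ :=
  (p.edges.map G.weight).sum

theorem length_nonneg {u v : V} (p : G.graph.Walk u v) : 0 ≤ G.length p :=
  List.sum_nonneg <| List.forall_mem_map.2 fun e he =>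
    G.weight_nonneg e (p.edges_subset_edgeSet he)

theorem length_nil {u : V} : G.length (Walk.nil : G.graph.Walk u u) = 0 :=
  rfl

theorem length_cons {u v w : V} (h : G.graph.Adj u v) (p : G.graph.Walk v w) :
    G.length (Walk.cons h p) = G.weight s(u, v) + G.length p :=
  rfl

theorem length_append {u v w : V} (p : G.graph.Walk u v) (p' : G.graph.Walk v w) :
    G.length (p.append p') = G.length p + G.length p' := by
  simp only [length, Walk.edges_append, List.map_append, List.sum_append]

theorem dist_le_length {u v : V} (p : G.graph.Walk u v) : G.dist u v ≤ G.length p :=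
  ciInf_le ⟨0, Set.forall_mem_range.2 G.length_nonneg⟩ p

theorem exists_length_lt {u v : V} {r : ℝ} (h : G.dist u v < r) :
    ∃ p : G.graph.Walk u v, G.length p < r :=
  have : Nonempty (G.graph.Walk u v) := G.connected.preconnected u v
  exists_lt_of_ciInf_lt h

theorem sub_le_dist (f : V → ℝ) (hf : ∀ u v, G.graph.Adj u v → f v - f u ≤ G.weight s(u, v))
    (u v : V) : f v - f u ≤ G.dist u v := by
  have : Nonempty (G.graph.Walk u v) := G.connected.preconnected u v
  refine le_ciInf fun p => ?_
  change f v - f u ≤ G.length p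
  clear this
  induction p with
  | nil => rw [sub_self, length_nil]
  | cons h p ih =>
    rw [length_cons]
    linarith [hf _ _ h]

/-- Two walks that meet can exchange their ends. -/
theorem dist_add_dist_le {u v u' v' x : V} {p : G.graph.Walk u v} {p' : G.graph.Walk u' v'}
    (hx : x ∈ p.support) (hx' : x ∈ p'.support) :
    G.dist u v' + G.dist u' v ≤ G.length p + G.length p' := by
  classical
  have h1 := G.dist_le_length ((p.takeUntil x hx).append (p'.dropUntil x hx'))
  have h2 := G.dist_le_length ((p'.takeUntil x hx').append (p.dropUntil x hx))
  have h3 := congrArg G.length (p.take_spec hx)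
  have h4 := congrArg G.length (p'.take_spec hx')
  rw [length_append] at h1 h2 h3 h4
  linarith

end Length

variable {T V V' : Type*} [Fintype V] [Fintype V'] {G : PlanarInstance T V}
  {H : PlanarInstance T V'} {ε : ℝ}

/-- Two nearly shortest walks of the emulator that meet could exchange their ends, and the resulting
walks would be too short. -/
theorem IsEmulator.exists_disjoint_walks (hHG : IsEmulator ε H G) {ι : Type*} {s t : ι → T}
    {D D' : ℝ} (hD : ∀ i, G.dist (G.terminal (s i)) (G.terminal (t i)) ≤ D)
    (hD' : Pairwise fun i j => 2 * D' ≤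
      G.dist (G.terminal (s i)) (G.terminal (t j)) + G.dist (G.terminal (s j)) (G.terminal (t i)))
    (hε : Real.exp (2 * ε) * D < D') :
    ∃ p : ∀ i, H.graph.Walk (H.terminal (s i)) (H.terminal (t i)),
      Pairwise fun i j => (p i).support.Disjoint (p j).support := by
  have hlt : Real.exp ε * D < Real.exp (-ε) * D' := by
    calc Real.exp ε * D = Real.exp (-ε) * (Real.exp (2 * ε) * D) := by
          rw [← mul_assoc, ← Real.exp_add]; ring_nf
      _ < Real.exp (-ε) * D' := by gcongr
  have hshort (i : ι) : ∃ p : H.graph.Walk (H.terminal (s i)) (H.terminal (t i)),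
      H.length p < Real.exp (-ε) * D' := by
    refine H.exists_length_lt (lt_of_le_of_lt ((hHG _ _).2.trans ?_) hlt)
    gcongr
    exact hD i
  choose p hp using hshort
  refine ⟨p, fun i j hij x hxi hxj => ?_⟩
  have hexchange := H.dist_add_dist_le hxi hxj
  have hfar := mul_le_mul_of_nonneg_left (hD' hij) (Real.exp_pos (-ε)).le
  linarith [hp i, hp j, (hHG (s i) (t j)).1, (hHG (s j) (t i)).1]

end PlanarInstance

namespace Grid

open SimpleGraph

/-- The lattice points of `[0, A) × [0, B)`. -/
noncomputable def points (A B : ℕ) : Finset (ℤ × ℤ) :=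
  Finset.Ico 0 (A : ℤ) ×ˢ Finset.Ico 0 (B : ℤ)

theorem mem_points {A B : ℕ} {p : ℤ × ℤ} :
    p ∈ points A B ↔ (0 ≤ p.1 ∧ p.1 < A) ∧ 0 ≤ p.2 ∧ p.2 < B := by
  simp only [points, Finset.mem_product, Finset.mem_Ico]

theorem card_points (A B : ℕ) : (points A B).card = A * B := by
  simp [points]

/-- The unit vectors in the four directions, in counterclockwise order. -/
def step : Fin 4 → ℤ × ℤ :=
  ![(1, 0), (0, 1), (-1, 0), (0, -1)]

theorem step_injective : Function.Injective step := by
  decide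

theorem step_ne_zero : ∀ i, step i ≠ 0 := by
  decide

theorem step_add_two : ∀ i, step (i + 2) = -step i := by
  decide

/-- The first direction after `i`, in counterclockwise order, that belongs to `S`. -/
def nextDir (S : Fin 4 → Bool) (i : Fin 4) : Fin 4 :=
  if S (i + 1) then i + 1 else if S (i + 2) then i + 2 else if S (i + 3) then i + 3 else i

theorem nextDir_mem : ∀ (S : Fin 4 → Bool) (i : Fin 4), S i → S (nextDir S i) := by
  decide

theorem nextDir_injOn :
    ∀ (S : Fin 4 → Bool) (i j : Fin 4), S i → S j → nextDir S i = nextDir S j → i = j := by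
  decide

theorem exists_iterate_nextDir : ∀ (S : Fin 4 → Bool) (i j : Fin 4), S i → S j →
    ∃ t : Fin 4, (nextDir S)^[t.1] i = j := by
  decide

variable (A B : ℕ)

/-- The grid graph: lattice points at distance one are adjacent. -/
def graph : SimpleGraph (points A B) where
  Adj v w := ∃ i, w.1 = v.1 + step i
  symm := ⟨fun v w ⟨i, hi⟩ => ⟨i + 2, by rw [hi, step_add_two, add_neg_cancel_right]⟩⟩
  loopless := ⟨fun _ ⟨i, hi⟩ => step_ne_zero i (left_eq_add.1 hi)⟩

/-- The set of the directions in which one can leave a point. -/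
noncomputable def avail (p : ℤ × ℤ) (i : Fin 4) : Bool :=
  p + step i ∈ points A B

variable {A B}

theorem avail_iff {p : ℤ × ℤ} {i : Fin 4} : avail A B p i ↔ p + step i ∈ points A B :=
  decide_eq_true_iff

/-- The direction of a dart. -/
noncomputable def dir (d : (graph A B).Dart) : Fin 4 :=
  d.adj.choose

theorem snd_eq (d : (graph A B).Dart) : d.snd.1 = d.fst.1 + step (dir d) :=
  d.adj.choose_spec

theorem avail_dir (d : (graph A B).Dart) : avail A B d.fst.1 (dir d) :=
  avail_iff.2 (snd_eq d ▸ d.snd.2)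

/-- The dart that leaves `v` in the direction `i`. -/
noncomputable def mkDart (v : points A B) (i : Fin 4) (h : avail A B v.1 i) : (graph A B).Dart :=
  ⟨(v, ⟨v.1 + step i, avail_iff.1 h⟩), ⟨i, rfl⟩⟩

theorem dir_mkDart (v : points A B) (i : Fin 4) (h : avail A B v.1 i) : dir (mkDart v i h) = i :=
  step_injective (add_left_cancel (snd_eq (mkDart v i h)).symm)

theorem dart_ext {d d' : (graph A B).Dart} (h : d.fst.1 = d'.fst.1) (h' : dir d = dir d') :
    d = d' :=
  Dart.ext _ _ <| Prod.ext (Subtype.ext h) <| Subtype.ext <| by rw [snd_eq, snd_eq, h, h']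

theorem dir_symm (d : (graph A B).Dart) : dir d.symm = dir d + 2 := by
  have h : d.fst.1 = d.snd.1 + step (dir d.symm) := snd_eq d.symm
  rw [snd_eq, add_assoc, left_eq_add] at h
  exact step_injective (by rw [step_add_two, eq_neg_of_add_eq_zero_right h])

/-- The dart that follows in counterclockwise order around the same tail. -/
noncomputable def nextDart (d : (graph A B).Dart) : (graph A B).Dart :=
  mkDart d.fst (nextDir (avail A B d.fst.1) (dir d)) (nextDir_mem _ _ (avail_dir d))

theorem dir_nextDart (d : (graph A B).Dart) :
    dir (nextDart d) = nextDir (avail A B d.fst.1) (dir d) :=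
  dir_mkDart _ _ _

theorem nextDart_injective : Function.Injective (nextDart : (graph A B).Dart → _) := by
  intro d d' h
  have hfst : d.fst = d'.fst := congrArg (fun e => e.fst) h
  have hdir := congrArg dir h
  rw [dir_nextDart, dir_nextDart, hfst] at hdir
  exact dart_ext (congrArg _ hfst) (nextDir_injOn _ _ _ (hfst ▸ avail_dir d) (avail_dir d') hdir)

instance : Finite (graph A B).Dart := by
  classical infer_instance

/-- The permutation of the darts of the grid that turns counterclockwise around their tails. -/
noncomputable def rot : Equiv.Perm (graph A B).Dart :=
  .ofBijective nextDart (Finite.injective_iff_bijective.1 nextDart_injective)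

theorem rot_cyclic (d d' : (graph A B).Dart) (h : d.fst = d'.fst) : rot.SameCycle d d' := by
  have hpow (n : ℕ) : ((rot ^ n) d).fst = d.fst ∧
      dir ((rot ^ n) d) = (nextDir (avail A B d.fst.1))^[n] (dir d) := by
    induction n with
    | zero => exact ⟨rfl, rfl⟩
    | succ n ih =>
      rw [pow_succ', Equiv.Perm.mul_apply, Function.iterate_succ_apply', ← ih.2, ← ih.1]
      exact ⟨rfl, dir_nextDart _⟩
  obtain ⟨t, ht⟩ := exists_iterate_nextDir _ _ _ (avail_dir d) (h ▸ avail_dir d')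
  exact ⟨t.1, dart_ext (congrArg _ ((hpow t).1.trans h)) ((hpow t).2.trans ht)⟩

theorem exists_add_step_mem_uIcc {u v : ℤ × ℤ} (h : u ≠ v) :
    ∃ i, u + step i ∈ Set.uIcc u v ∧ (v.1 - (u + step i).1).natAbs + (v.2 - (u + step i).2).natAbs <
      (v.1 - u.1).natAbs + (v.2 - u.2).natAbs := by
  obtain ⟨x, y⟩ := u
  obtain ⟨x', y'⟩ := v
  simp only [ne_eq, Prod.mk.injEq] at h
  simp only [Set.uIcc_prod_eq, Set.mem_prod, Set.mem_uIcc, Fin.exists_fin_succ, IsEmpty.exists_iff,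
    step, Fin.reduceSucc, Fin.succ_zero_eq_one, Fin.succ_one_eq_two, Matrix.cons_val,
    Prod.mk_add_mk]
  omega

theorem exists_walk_support_subset_uIcc (u v : points A B) :
    ∃ p : (graph A B).Walk u v, ∀ w ∈ p.support, w.1 ∈ Set.uIcc u.1 v.1 := by
  induction hn : (v.1.1 - u.1.1).natAbs + (v.1.2 - u.1.2).natAbs using Nat.strong_induction_on
    generalizing u with
  | _ n ih =>
  by_cases huv : u = v
  · subst huv
    exact ⟨.nil, by simp⟩
  obtain ⟨i, hmem, hlt⟩ := exists_add_step_mem_uIcc (Subtype.coe_ne_coe.2 huv)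
  have hpoint : u.1 + step i ∈ points A B := by
    have hu := mem_points.1 u.2
    have hv := mem_points.1 v.2
    simp only [Set.uIcc_prod_eq, Set.mem_prod, Set.mem_uIcc] at hmem
    exact mem_points.2 (by omega)
  have hadj : (graph A B).Adj u ⟨u.1 + step i, hpoint⟩ := ⟨i, rfl⟩
  obtain ⟨p, hp⟩ := ih _ (hn ▸ hlt) ⟨u.1 + step i, hpoint⟩ rfl
  refine ⟨.cons hadj p, fun w hw => ?_⟩
  rw [Walk.support_cons, List.mem_cons] at hw
  rcases hw with rfl | hw
  · exact Set.left_mem_uIcc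
  · exact Set.uIcc_subset_uIcc hmem Set.right_mem_uIcc (hp w hw)

theorem hasDisjointWalks_of_disjoint_uIcc {u v u' v' : points A B}
    (h : Disjoint (Set.uIcc u.1 v.1) (Set.uIcc u'.1 v'.1)) :
    HasDisjointWalks (graph A B) u v u' v' := by
  obtain ⟨P, hP⟩ := exists_walk_support_subset_uIcc u v
  obtain ⟨Q, hQ⟩ := exists_walk_support_subset_uIcc u' v'
  exact ⟨P, Q, fun x hx hx' => Set.disjoint_left.1 h (hP x hx) (hQ x hx')⟩

theorem connected [NeZero A] [NeZero B] : (graph A B).Connected :=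
  have : Nonempty (points A B) := ⟨⟨(0, 0), mem_points.2 (by simp [NeZero.pos])⟩⟩
  ⟨fun u v => ⟨(exists_walk_support_subset_uIcc u v).choose⟩⟩

variable (A B) in
/-- The grid with its counterclockwise rotation system. -/
noncomputable def rotationSystem [NeZero A] [NeZero B] : RotationSystem (points A B) where
  graph := graph A B
  connected := connected
  rot := rot
  rot_fst _ := rfl
  rot_cyclic := rot_cyclic

/-- The lower left corner of the cell to the right of the segment from `p` in the direction `i`. -/
def rightCell (p : ℤ × ℤ) (i : Fin 4) : ℤ × ℤ :=
  p + ![(0, -1), (0, 0), (-1, 0), (-1, -1)] i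

variable {a b : ℕ}

theorem rightCell_nextDir [NeZero a] {p : ℤ × ℤ} {i : Fin 4} (hp : p ∈ points (a + 1) (b + 1))
    (hi : p + step i ∈ points (a + 1) (b + 1)) :
    rightCell (p + step i) (nextDir (avail (a + 1) (b + 1) (p + step i)) (i + 2)) =
        rightCell p i ∨
      rightCell (p + step i) (nextDir (avail (a + 1) (b + 1) (p + step i)) (i + 2)) ∉
          points a b ∧
        rightCell p i ∉ points a b := by
  have ha := NeZero.pos a
  obtain ⟨x, y⟩ := p
  rw [mem_points] at hp hi
  fin_cases i <;>
    simp only [nextDir, avail_iff, mem_points, step, rightCell, Fin.reduceFinMk, Fin.zero_eta,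
      Fin.mk_one, Fin.reduceAdd, Fin.isValue, zero_add, Matrix.cons_val,
      Prod.mk_add_mk] at hp hi ⊢ <;>
    split_ifs <;> simp only [Matrix.cons_val, Prod.mk_add_mk, Prod.mk.injEq] <;> omega

/-- The cell with the lower left corner `c`, or `none`, for the outer face, if there is no such
cell. -/
noncomputable def toCell (c : ℤ × ℤ) : Option (points a b) :=
  if h : c ∈ points a b then some ⟨c, h⟩ else none

theorem toCell_eq_none {c : ℤ × ℤ} (h : c ∉ points a b) : (toCell c : Option (points a b)) = none :=
  dif_neg h

theorem toCell_coe (c : points a b) : toCell c.1 = some c :=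
  dif_pos c.2

/-- The cell to the right of a dart. -/
noncomputable def cell (d : (graph (a + 1) (b + 1)).Dart) : Option (points a b) :=
  toCell (rightCell d.fst.1 (dir d))

theorem cell_mkDart (v : points (a + 1) (b + 1)) (i : Fin 4) (h : avail (a + 1) (b + 1) v.1 i) :
    cell (mkDart v i h) = toCell (rightCell v.1 i) :=
  congrArg (fun j => toCell (rightCell v.1 j)) (dir_mkDart v i h)

theorem cell_faceNext [NeZero a] (d : (graph (a + 1) (b + 1)).Dart) :
    cell ((rotationSystem (a + 1) (b + 1)).faceNext d) = cell d := by
  have hnext : cell ((rotationSystem (a + 1) (b + 1)).faceNext d) =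
      toCell (rightCell (d.fst.1 + step (dir d))
        (nextDir (avail (a + 1) (b + 1) (d.fst.1 + step (dir d))) (dir d + 2))) := by
    rw [← snd_eq, ← dir_symm]
    exact cell_mkDart d.snd _ (nextDir_mem _ _ (avail_dir d.symm))
  rw [hnext, cell]
  rcases rightCell_nextDir d.fst.2 (avail_iff.1 (avail_dir d)) with h | ⟨h, h'⟩
  · rw [h]
  · rw [toCell_eq_none h, toCell_eq_none h']

/-- The cell inside a face of the grid. -/
noncomputable def faceCell [NeZero a] :
    (rotationSystem (a + 1) (b + 1)).Face → Option (points a b) :=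
  Quotient.lift cell fun _ _ h => eq_of_sameCycle cell_faceNext h

variable (a b) in
/-- The first dart of the lower side of the grid. -/
noncomputable def lowerDart [NeZero a] : (graph (a + 1) (b + 1)).Dart :=
  mkDart ⟨(0, 0), mem_points.2 (by simp)⟩ 0
    (avail_iff.2 (mem_points.2 (by simp [step, NeZero.pos])))

theorem cell_lowerDart [NeZero a] : cell (lowerDart a b) = none :=
  (cell_mkDart _ _ _).trans (toCell_eq_none (by simp [mem_points, rightCell]))

theorem faceCell_surjective [NeZero a] :
    Function.Surjective (faceCell : (rotationSystem (a + 1) (b + 1)).Face → _) := by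
  rintro (_ | c)
  · exact ⟨(rotationSystem (a + 1) (b + 1)).face (lowerDart a b), cell_lowerDart⟩
  · have hc := mem_points.1 c.2
    let d : (graph (a + 1) (b + 1)).Dart :=
      mkDart ⟨c.1, mem_points.2 (by push_cast; omega)⟩ 1
        (avail_iff.2 (mem_points.2 (by
          simp only [step, Matrix.cons_val, Prod.fst_add, Prod.snd_add]
          omega)))
    have hd : cell d = some c :=
      (cell_mkDart _ _ _).trans <| (congrArg toCell (add_zero c.1)).trans (toCell_coe c)
    exact ⟨(rotationSystem (a + 1) (b + 1)).face d, hd⟩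

theorem exists_dart_edge_eq (e : (graph A B).edgeSet) :
    ∃ d : (graph A B).Dart, d.edge = e ∧ (dir d = 0 ∨ dir d = 1) := by
  obtain ⟨⟨v, w⟩, h⟩ := e
  let d : (graph A B).Dart := ⟨(v, w), h⟩
  by_cases hd : dir d = 0 ∨ dir d = 1
  · exact ⟨d, rfl, hd⟩
  · exact ⟨d.symm, Sym2.eq_swap, by rw [dir_symm]; omega⟩

theorem card_edgeSet_le :
    Nat.card (graph (a + 1) (b + 1)).edgeSet ≤ a * (b + 1) + (a + 1) * b := by
  choose d hedge hdir using exists_dart_edge_eq (A := a + 1) (B := b + 1)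
  let S := points a (b + 1) ×ˢ {(0 : Fin 4)} ∪ points (a + 1) b ×ˢ {1}
  have hS (e) : ((d e).fst.1, dir (d e)) ∈ S := by
    have hfst := mem_points.1 (d e).fst.2
    have hsnd := mem_points.1 (d e).snd.2
    rw [snd_eq] at hsnd
    simp only [S, Finset.mem_union, Finset.mem_product, Finset.mem_singleton, mem_points]
    rcases hdir e with h | h <;> rw [h] at hsnd ⊢ <;>
      simp only [step, Matrix.cons_val, Prod.fst_add, Prod.snd_add] at hsnd <;> omega
  have hinj : Function.Injective fun e => (⟨_, hS e⟩ : S) := by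
    intro e e' h
    have h' := Prod.ext_iff.1 (congrArg Subtype.val h)
    exact Subtype.ext (by rw [← hedge e, ← hedge e', dart_ext h'.1 h'.2])
  calc Nat.card (graph (a + 1) (b + 1)).edgeSet ≤ Nat.card S :=
        Nat.card_le_card_of_injective _ hinj
    _ = S.card := by simp
    _ ≤ _ := (Finset.card_union_le _ _).trans_eq (by simp [card_points])

theorem card_option_points : Nat.card (Option (points a b)) = a * b + 1 := by
  simp [card_points]

theorem card_edgeSet_add_two_le :
    Nat.card (graph (a + 1) (b + 1)).edgeSet + 2 ≤
      Fintype.card (points (a + 1) (b + 1)) + Nat.card (Option (points a b)) := by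
  rw [Fintype.card_coe, card_points, card_option_points]
  linarith [card_edgeSet_le (a := a) (b := b)]

theorem isPlanar [NeZero a] : (rotationSystem (a + 1) (b + 1)).IsPlanar :=
  le_antisymm (RotationSystem.card_add_card_face_le _) <| card_edgeSet_add_two_le.trans <|
    Nat.add_le_add_left (Nat.card_le_card_of_surjective _ faceCell_surjective) _

theorem faceCell_injective [NeZero a] :
    Function.Injective (faceCell : (rotationSystem (a + 1) (b + 1)).Face → _) := by
  refine (faceCell_surjective.bijective_of_nat_card_le ?_).1
  have h := (rotationSystem (a + 1) (b + 1)).card_add_card_face_le.trans card_edgeSet_add_two_le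
  exact Nat.le_of_add_le_add_left h

variable (a b) in
/-- The grid with `a` columns and `b` rows of cells as a plane graph. -/
noncomputable def planeGraph [NeZero a] : PlaneGraph (points (a + 1) (b + 1)) :=
  (rotationSystem (a + 1) (b + 1)).toPlaneGraph isPlanar (lowerDart a b)

theorem sameCycle_outer [NeZero a] {d : (graph (a + 1) (b + 1)).Dart} (hd : cell d = none) :
    (planeGraph a b).faceNext.SameCycle (planeGraph a b).outer d :=
  Quotient.exact (faceCell_injective (cell_lowerDart.trans hd.symm))

theorem onOuterFace [NeZero a] [NeZero b] {v : points (a + 1) (b + 1)}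
    (hv : v.1.2 = 0 ∨ v.1.2 = b) : (planeGraph a b).OnOuterFace v := by
  obtain ⟨i, hi, hcell⟩ : ∃ i, avail (a + 1) (b + 1) v.1 i ∧ rightCell v.1 i ∉ points a b := by
    have ha := NeZero.pos a
    have hb := NeZero.pos b
    have hm := mem_points.1 v.2
    simp only [avail_iff, mem_points]
    push_cast at hm ⊢
    rcases hv with hv | hv
    · by_cases hx : v.1.1 < a
      · refine ⟨0, ?_⟩
        simp only [step, rightCell, Matrix.cons_val, Prod.fst_add, Prod.snd_add]
        omega
      · refine ⟨1, ?_⟩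
        simp only [step, rightCell, Matrix.cons_val, Prod.fst_add, Prod.snd_add]
        omega
    · by_cases hx : 0 < v.1.1
      · refine ⟨2, ?_⟩
        simp only [step, rightCell, Matrix.cons_val, Prod.fst_add, Prod.snd_add]
        omega
      · refine ⟨3, ?_⟩
        simp only [step, rightCell, Matrix.cons_val, Prod.fst_add, Prod.snd_add]
        omega
  exact ⟨mkDart v i hi, sameCycle_outer ((cell_mkDart v i hi).trans (toCell_eq_none hcell)), rfl⟩

section Instance

open PlanarInstance

/-- The potential whose differences are the edge weights. From a point with even coordinate sum it
increases by one with each step of a staircase: up, sideways, up, sideways, … -/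
def potential (p : ℤ × ℤ) : ℤ :=
  2 * p.2 - (p.1 + p.2) % 2

theorem one_le_abs_potential_sub {A B : ℕ} {u v : points A B} (h : (graph A B).Adj u v) :
    1 ≤ |potential u.1 - potential v.1| := by
  obtain ⟨i, hi⟩ := h
  refine Int.one_le_abs fun h => ?_
  rw [hi] at h
  fin_cases i <;>
    simp only [potential, step, Fin.reduceFinMk, Fin.zero_eta, Fin.mk_one, Matrix.cons_val,
      Prod.fst_add, Prod.snd_add] at h <;> omega

/-- The position of the `t`-th of `k` terminals: `k / 2` of them on the lower side and `k / 2` on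
the upper side, at even abscissas, and the last one, if `k` is odd, on the lower side again. -/
def terminalPos (k q t : ℕ) : ℤ × ℤ :=
  if t < k / 2 then (2 * t, 0) else if t < 2 * (k / 2) then (2 * (t - (k / 2 : ℕ)), 2 * q)
  else (k, 0)

theorem terminalPos_mem (k q t : ℕ) :
    terminalPos k q t ∈ points (k + 1 + 1) (2 * q + 1) := by
  rw [mem_points, terminalPos]
  split_ifs <;> refine ⟨⟨?_, ?_⟩, ?_, ?_⟩ <;> dsimp only <;> omega

theorem terminalPos_injOn (k q : ℕ) [NeZero q] : Set.InjOn (terminalPos k q) (Set.Iio k) := by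
  intro s hs t ht h
  have hq := NeZero.pos q
  rw [Set.mem_Iio] at hs ht
  rw [terminalPos, terminalPos] at h
  split_ifs at h <;> rw [Prod.mk.injEq] at h <;> omega

variable (k q : ℕ) [NeZero q]

/-- The weighted grid with `k + 1` columns and `2 q` rows of cells and with `k` terminals. -/
noncomputable def gridInstance : PlanarInstance (Fin k) (points (k + 1 + 1) (2 * q + 1)) where
  toPlaneGraph := planeGraph (k + 1) (2 * q)
  weight := Sym2.lift ⟨fun u v => ((|potential u.1 - potential v.1| : ℤ) : ℝ),
    fun _ _ => congrArg _ (abs_sub_comm _ _)⟩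
  weight_nonneg := Sym2.ind fun _ _ _ => Int.cast_nonneg (abs_nonneg _)
  terminal := ⟨fun t => ⟨terminalPos k q t, terminalPos_mem k q t⟩, fun s t h =>
    Fin.ext (terminalPos_injOn k q s.2 t.2 (congrArg Subtype.val h))⟩

variable {k q}

theorem weight_mk (u v : points (k + 1 + 1) (2 * q + 1)) :
    (gridInstance k q).weight s(u, v) = ((|potential u.1 - potential v.1| : ℤ) : ℝ) :=
  rfl

theorem weight_pos {e : Sym2 (points (k + 1 + 1) (2 * q + 1))}
    (he : e ∈ (gridInstance k q).graph.edgeSet) : 0 < (gridInstance k q).weight e := by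
  induction e with
  | _ u v => exact Int.cast_pos.2 (zero_lt_one.trans_le (one_le_abs_potential_sub he))

theorem isOneHole_gridInstance : (gridInstance k q).IsOneHole := by
  intro t
  refine onOuterFace ?_
  change (terminalPos k q t).2 = 0 ∨ (terminalPos k q t).2 = _
  rw [terminalPos]
  split_ifs <;> simp

/-- The `i`-th terminal on the lower side of the grid. -/
def lower (i : Fin (k / 2)) : Fin k :=
  ⟨i, by omega⟩

/-- The `i`-th terminal on the upper side of the grid, opposite `lower i`. -/
def upper (i : Fin (k / 2)) : Fin k :=
  ⟨k / 2 + i, by omega⟩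

theorem terminal_lower (i : Fin (k / 2)) :
    ((gridInstance k q).terminal (lower i)).1 = (2 * (i : ℤ), 0) :=
  if_pos i.2

theorem terminal_upper (i : Fin (k / 2)) :
    ((gridInstance k q).terminal (upper i)).1 = (2 * (i : ℤ), 2 * (q : ℤ)) := by
  change terminalPos k q (k / 2 + i) = _
  rw [terminalPos, if_neg (by omega), if_pos (by omega), Nat.cast_add, add_sub_cancel_left]

theorem exists_diagonal {σ : ℤ} (hσ : σ = 1 ∨ σ = -1) {u v : points (k + 1 + 1) (2 * q + 1)}
    (hu : (u.1.1 + u.1.2) % 2 = 0) (hv : v.1 = u.1 + (σ, 1)) :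
    ∃ p : (gridInstance k q).graph.Walk u v, (gridInstance k q).length p = 2 := by
  obtain ⟨i, hi⟩ : ∃ i, step i = (σ, 0) := by
    rcases hσ with rfl | rfl
    · exact ⟨0, rfl⟩
    · exact ⟨2, rfl⟩
  have hw : u.1 + step 1 ∈ points (k + 1 + 1) (2 * q + 1) := by
    have hmem := mem_points.1 u.2
    have hmem' := mem_points.1 v.2
    rw [hv] at hmem'
    simp only [mem_points, step, Matrix.cons_val, Prod.fst_add, Prod.snd_add] at hmem' ⊢
    omega
  have huw : (gridInstance k q).graph.Adj u ⟨u.1 + step 1, hw⟩ := ⟨1, rfl⟩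
  have hwv : (gridInstance k q).graph.Adj ⟨u.1 + step 1, hw⟩ v :=
    ⟨i, by simp only [hv, hi, add_assoc]; simp [step]⟩
  have h₁ : potential u.1 - potential (u.1 + step 1) = -1 := by
    simp only [potential, step, Matrix.cons_val, Prod.fst_add, Prod.snd_add]
    omega
  have h₂ : potential (u.1 + step 1) - potential v.1 = -1 := by
    rw [hv]
    simp only [potential, step, Matrix.cons_val, Prod.fst_add, Prod.snd_add]
    omega
  refine ⟨.cons huw (.cons hwv .nil), ?_⟩
  rw [length_cons, length_cons, length_nil, weight_mk, weight_mk, h₁, h₂]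
  norm_num

theorem exists_staircase {σ : ℤ} (hσ : σ = 1 ∨ σ = -1) (n : ℕ)
    {u v : points (k + 1 + 1) (2 * q + 1)} (hu : (u.1.1 + u.1.2) % 2 = 0)
    (hv : v.1 = u.1 + (σ * n, (n : ℤ))) :
    ∃ p : (gridInstance k q).graph.Walk u v, (gridInstance k q).length p = 2 * n := by
  induction n generalizing u with
  | zero =>
    obtain rfl : v = u := Subtype.ext (hv.trans (by simp [Prod.mk_zero_zero]))
    exact ⟨.nil, by simp [length_nil]⟩
  | succ n ih =>
    have hw : u.1 + (σ, 1) ∈ points (k + 1 + 1) (2 * q + 1) := by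
      have hmem := mem_points.1 u.2
      have hmem' := mem_points.1 v.2
      rw [hv] at hmem'
      simp only [mem_points, Prod.fst_add, Prod.snd_add] at hmem' ⊢
      rcases hσ with rfl | rfl <;> omega
    obtain ⟨p, hp⟩ := exists_diagonal (v := ⟨u.1 + (σ, 1), hw⟩) hσ hu rfl
    obtain ⟨p', hp'⟩ := ih (u := ⟨u.1 + (σ, 1), hw⟩)
      (by simp only [Prod.fst_add, Prod.snd_add]; omega)
      (hv.trans (by ext <;> simp <;> ring))
    refine ⟨p.append p', ?_⟩
    rw [length_append, hp, hp']
    push_cast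
    ring

theorem dist_lower_upper_le {i j : Fin (k / 2)} (h : |(j : ℤ) - i| = q) :
    (gridInstance k q).dist ((gridInstance k q).terminal (lower i))
      ((gridInstance k q).terminal (upper j)) ≤ 4 * q := by
  obtain ⟨σ, hσ, hij⟩ : ∃ σ : ℤ, (σ = 1 ∨ σ = -1) ∧ (j : ℤ) = i + σ * q := by
    rcases abs_choice ((j : ℤ) - i) with h' | h'
    · exact ⟨1, .inl rfl, by omega⟩
    · exact ⟨-1, .inr rfl, by omega⟩
  obtain ⟨p, hp⟩ := exists_staircase (u := (gridInstance k q).terminal (lower i))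
    (v := (gridInstance k q).terminal (upper j)) hσ (2 * q)
    (by rw [terminal_lower]; simp)
    (by rw [terminal_lower, terminal_upper, hij]; ext <;> simp; ring)
  refine (dist_le_length _ p).trans_eq ?_
  rw [hp]
  push_cast
  ring

theorem potential_sub_le_dist (u v : points (k + 1 + 1) (2 * q + 1)) :
    ((potential v.1 - potential u.1 : ℤ) : ℝ) ≤ (gridInstance k q).dist u v := by
  rw [Int.cast_sub]
  refine (gridInstance k q).sub_le_dist (fun v => (potential v.1 : ℝ)) (fun u v _ => ?_) u v
  rw [weight_mk, abs_sub_comm, ← Int.cast_sub]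
  exact Int.cast_le.2 (le_abs_self _)

theorem sub_le_dist_of_step_le_one {f : ℤ × ℤ → ℤ} (hf : ∀ p i, f (p + step i) - f p ≤ 1)
    (u v : points (k + 1 + 1) (2 * q + 1)) :
    ((f v.1 - f u.1 : ℤ) : ℝ) ≤ (gridInstance k q).dist u v := by
  rw [Int.cast_sub]
  refine (gridInstance k q).sub_le_dist (fun v => (f v.1 : ℝ)) (fun u v h => ?_) u v
  rw [weight_mk, ← Int.cast_sub]
  refine Int.cast_le.2 (le_trans ?_ (one_le_abs_potential_sub h))
  obtain ⟨i, hi⟩ := h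
  exact hi ▸ hf u.1 i

theorem four_mul_le_dist_lower_upper (i j : Fin (k / 2)) :
    ((4 * q : ℤ) : ℝ) ≤ (gridInstance k q).dist ((gridInstance k q).terminal (lower i))
      ((gridInstance k q).terminal (upper j)) := by
  have h := potential_sub_le_dist ((gridInstance k q).terminal (lower i))
    ((gridInstance k q).terminal (upper j))
  rw [terminal_lower, terminal_upper] at h
  refine le_of_eq_of_le (congrArg _ ?_) h
  simp only [potential]
  omega

theorem le_dist_lower_upper (i j : Fin (k / 2)) :
    ((2 * q + 2 * |(j : ℤ) - i| : ℤ) : ℝ) ≤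
      (gridInstance k q).dist ((gridInstance k q).terminal (lower i))
        ((gridInstance k q).terminal (upper j)) := by
  have h₁ := sub_le_dist_of_step_le_one (f := fun p => p.2 + p.1)
    (by intro p i; fin_cases i <;> simp [step]) ((gridInstance k q).terminal (lower i))
    ((gridInstance k q).terminal (upper j))
  have h₂ := sub_le_dist_of_step_le_one (f := fun p => p.2 - p.1)
    (by intro p i; fin_cases i <;> simp [step]) ((gridInstance k q).terminal (lower i))
    ((gridInstance k q).terminal (upper j))
  rw [terminal_lower, terminal_upper] at h₁ h₂
  rcases abs_choice ((j : ℤ) - i) with h | h <;> rw [h]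
  · exact le_of_eq_of_le (congrArg _ (by ring)) h₁
  · exact le_of_eq_of_le (congrArg _ (by ring)) h₂

theorem le_dist_add_dist {c : ℤ} (hc : |c| = q) {i j i' j' : Fin (k / 2)} (hij : (j : ℤ) = i + c)
    (hij' : (j' : ℤ) = i' + c) (hne : i ≠ i') :
    2 * (4 * q + 1 : ℝ) ≤
      (gridInstance k q).dist ((gridInstance k q).terminal (lower i))
          ((gridInstance k q).terminal (upper j')) +
        (gridInstance k q).dist ((gridInstance k q).terminal (lower i'))
          ((gridInstance k q).terminal (upper j)) := by
  rw [ne_eq, Fin.ext_iff] at hne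
  have hfar : (q : ℤ) + 1 ≤ |(j' : ℤ) - i| ∨ (q : ℤ) + 1 ≤ |(j : ℤ) - i'| := by
    simp only [le_abs']
    rcases abs_choice c with h | h <;> omega
  have h₁ := four_mul_le_dist_lower_upper (q := q) i j'
  have h₂ := le_dist_lower_upper (q := q) i j'
  have h₃ := four_mul_le_dist_lower_upper (q := q) i' j
  have h₄ := le_dist_lower_upper (q := q) i' j
  rcases hfar with h | h <;> rify at h <;> push_cast at h₁ h₂ h₃ h₄ <;> linarith

variable {V' : Type*} [Fintype V'] {H : PlanarInstance (Fin k) V'} {ε : ℝ}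

theorem not_hasDisjointWalks_of_max_lt_min (hH : SameOuterOrder H (gridInstance k q))
    {i j i' j' : Fin (k / 2)} (h : max i j' < min i' j) :
    ¬ HasDisjointWalks H.graph (H.terminal (lower i)) (H.terminal (upper j))
      (H.terminal (lower i')) (H.terminal (upper j')) := by
  have hq := NeZero.pos q
  simp only [lt_min_iff, max_lt_iff, Fin.lt_def] at h
  refine hH.not_hasDisjointWalks ?_ ?_ ?_ ?_ ?_ ?_
    (hasDisjointWalks_of_disjoint_uIcc ?_) (hasDisjointWalks_of_disjoint_uIcc ?_)
  iterate 6 simp only [ne_eq, lower, upper, Fin.mk.injEq]; omega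
  all_goals
    simp only [terminal_lower, terminal_upper, Set.disjoint_left, Set.uIcc_prod_eq, Set.mem_prod,
      Set.mem_uIcc]
    omega

theorem le_card_of_isAlignedEmulator (hε : Real.exp (2 * ε) * (4 * q) < 4 * q + 1)
    (hH : IsAlignedEmulator ε H (gridInstance k q)) :
    (k / 2 - 2 * q) * q ≤ Fintype.card V' := by
  obtain ⟨hemulator, -, horder⟩ := hH
  obtain ⟨P, hP⟩ := hemulator.exists_disjoint_walks (ι := Fin (k / 2 - q)) (D := 4 * q)
    (D' := 4 * q + 1) (s := fun i => lower ⟨i, by omega⟩) (t := fun i => upper ⟨i + q, by omega⟩)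
    (fun i => dist_lower_upper_le (by simp))
    (fun i j hij => le_dist_add_dist (c := q) (by simp) (by simp) (by simp)
      (by simpa [Fin.ext_iff] using hij)) hε
  obtain ⟨Q, hQ⟩ := hemulator.exists_disjoint_walks (ι := Fin (k / 2 - q)) (D := 4 * q)
    (D' := 4 * q + 1) (s := fun i => lower ⟨i + q, by omega⟩) (t := fun i => upper ⟨i, by omega⟩)
    (fun i => dist_lower_upper_le (by simp))
    (fun i j hij => le_dist_add_dist (c := -q) (by simp) (by simp) (by simp)
      (by simpa [Fin.ext_iff] using hij)) hε
  have hleft (z : Fin (k / 2 - 2 * q) × Fin q) : z.1.1 < k / 2 - q := by omega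
  have hright (z : Fin (k / 2 - 2 * q) × Fin q) : z.1.1 + z.2.1 < k / 2 - q := by omega
  have hmeet (z : Fin (k / 2 - 2 * q) × Fin q) :
      ∃ x ∈ (P ⟨z.1, hleft z⟩).support, x ∈ (Q ⟨z.1 + z.2, hright z⟩).support := by
    by_contra! hdisj
    refine not_hasDisjointWalks_of_max_lt_min horder
      (i := ⟨z.1, by omega⟩) (j := ⟨z.1 + q, by omega⟩)
      (i' := ⟨z.1 + z.2 + q, by omega⟩) (j' := ⟨z.1 + z.2, by omega⟩) ?_
      ⟨P ⟨z.1, hleft z⟩, Q ⟨z.1 + z.2, hright z⟩, fun x hxP hxQ => hdisj x hxP hxQ⟩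
    simp only [lt_min_iff, max_lt_iff, Fin.lt_def]
    have hlt := z.2.2
    omega
  choose x hxP hxQ using hmeet
  have hinj : Function.Injective x := by
    rintro z z' h
    have hz := hP.eq fun hd => hd (hxP z) (h ▸ hxP z')
    have hz' := hQ.eq fun hd => hd (hxQ z) (h ▸ hxQ z')
    rw [Fin.mk.injEq] at hz hz'
    exact Prod.ext (Fin.ext hz) (Fin.ext (by omega))
  simpa using Fintype.card_le_of_injective x hinj

theorem mul_div_four_le {t : ℝ} (ht : 1 ≤ t) (hk : 64 * t ≤ k) :
    k * t / 4 ≤ (((k / 2 - 2 * (⌊t⌋₊ + 1)) * (⌊t⌋₊ + 1) : ℕ) : ℝ) := by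
  have hfloor := Nat.floor_le (zero_le_one.trans ht)
  have hlt := (Nat.lt_floor_add_one t).le
  have hhalf : (k : ℝ) ≤ 2 * (k / 2 : ℕ) + 1 := by exact_mod_cast (by omega : k ≤ 2 * (k / 2) + 1)
  generalize k / 2 = m at hhalf ⊢
  have hle : 2 * (⌊t⌋₊ + 1) ≤ m := by
    rify
    linarith
  have hsub : (k : ℝ) / 4 ≤ (m - 2 * (⌊t⌋₊ + 1) : ℕ) := by
    push_cast [hle]
    linarith
  calc k * t / 4 = k / 4 * t := by ring
    _ ≤ (m - 2 * (⌊t⌋₊ + 1) : ℕ) * (⌊t⌋₊ + 1) := by gcongr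
    _ = _ := by push_cast; rfl

theorem exp_two_mul_mul_lt {x : ℝ} (hε : 0 ≤ ε) (hε' : 2 * ε ≤ 1) (hx : 0 ≤ x)
    (h : 16 * ε * x < 1) : Real.exp (2 * ε) * (4 * x) < 4 * x + 1 := by
  have habs : |2 * ε| = 2 * ε := abs_of_nonneg (by linarith)
  have hexp : Real.exp (2 * ε) ≤ 1 + 4 * ε := by
    have := (le_abs_self _).trans (Real.abs_exp_sub_one_le (habs.trans_le hε'))
    linarith
  calc Real.exp (2 * ε) * (4 * x) ≤ (1 + 4 * ε) * (4 * x) := by gcongr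
    _ < 4 * x + 1 := by linarith

theorem mul_div_four_le_card_of_isAlignedEmulator {t : ℝ} (ht : 1 ≤ t) (hk : 64 * t ≤ k)
    (hε : 0 < ε) (hεt : 64 * t ≤ 1 / ε) (hH : IsAlignedEmulator ε H (gridInstance k (⌊t⌋₊ + 1))) :
    k * t / 4 ≤ Fintype.card V' := by
  have hfloor := Nat.floor_le (zero_le_one.trans ht)
  rw [le_div_iff₀ hε] at hεt
  have hexp : Real.exp (2 * ε) * (4 * (⌊t⌋₊ + 1 : ℕ)) < 4 * (⌊t⌋₊ + 1 : ℕ) + 1 := by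
    refine exp_two_mul_mul_lt hε.le (by nlinarith) (Nat.cast_nonneg _) ?_
    push_cast
    nlinarith
  exact (mul_div_four_le ht hk).trans (Nat.cast_le.2 (le_card_of_isAlignedEmulator hexp hH))

end Instance

end Grid

theorem theorem3p2_general.{u} :
    ∃ c : ℝ, 0 < c ∧
      ∀ (k : ℕ) (ε : ℝ), 0 < ε →
        ∃ (V : Type) (_ : Fintype V) (G : PlanarInstance (Fin k) V),
          G.IsOneHole ∧ (∀ e ∈ G.graph.edgeSet, 0 < G.weight e) ∧
          ∀ (V' : Type u) (_ : Fintype V') (G' : PlanarInstance (Fin k) V'),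
            PlanarInstance.IsAlignedEmulator ε G' G →
              c * min ((k : ℝ) ^ 2) (k / ε) ≤ (Fintype.card V' : ℝ) := by
  refine ⟨1 / 256, by norm_num, fun k ε hε => ?_⟩
  set t : ℝ := min (k : ℝ) (1 / ε) / 64 with ht
  have hmin : 1 / 256 * min ((k : ℝ) ^ 2) (k / ε) = k * t / 4 := by
    rw [ht, sq, div_eq_mul_one_div (k : ℝ) ε, ← mul_min_of_nonneg _ _ k.cast_nonneg]
    ring
  refine ⟨_, _, Grid.gridInstance k (⌊t⌋₊ + 1), Grid.isOneHole_gridInstance,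
    fun _ he => Grid.weight_pos he, fun V' _ G' hG' => hmin.trans_le ?_⟩
  rcases lt_or_ge t 1 with ht1 | ht1
  · have hcard : (k : ℝ) ≤ Fintype.card V' := by
      exact_mod_cast (Fintype.card_fin k).symm.trans_le (Fintype.card_le_of_embedding G'.terminal)
    nlinarith [(Nat.cast_nonneg k : (0 : ℝ) ≤ k)]
  · have h64 : 64 * t = min (k : ℝ) (1 / ε) := mul_div_cancel₀ _ (by norm_num)
    exact Grid.mul_div_four_le_card_of_isAlignedEmulator ht1 (h64.trans_le (min_le_left _ _)) hε
      (h64.trans_le (min_le_right _ _)) hG'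

theorem theorem3p2 :
    ∃ c : ℝ, 0 < c ∧
      ∀ (k : ℕ) (ε : ℝ), 2 ≤ k → 4 / (k : ℝ) < ε → ε < 1 →
        ∃ (V : Type) (_ : Fintype V) (G : PlanarInstance (Fin k) V),
          G.IsOneHole ∧ (∀ e ∈ G.graph.edgeSet, 0 < G.weight e) ∧
          ∀ (V' : Type) (_ : Fintype V') (G' : PlanarInstance (Fin k) V'),
            PlanarInstance.IsAlignedEmulator ε G' G →
              c * ((k : ℝ) / ε) ≤ (Fintype.card V' : ℝ) := by
  obtain ⟨c, hc, h⟩ := theorem3p2_general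
  refine ⟨c, hc, fun k ε hk hkε _ => ?_⟩
  have hk' : (0 : ℝ) < k := Nat.cast_pos.2 (by omega)
  have hε : 0 < ε := (div_pos four_pos hk').trans hkε
  have hmin : (k : ℝ) / ε ≤ k ^ 2 := by
    rw [div_lt_iff₀ hk'] at hkε
    rw [div_le_iff₀ hε]
    nlinarith
  simpa only [min_eq_right hmin] using h k ε hε
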